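/- Let $n\ge 1$ and let $\mathbf e=(e_1,\dots,e_n)$ with each $e_i\in\{1,-1\}$. Put $\mathbf e(n)=(\epsilon_1,\dots,\epsilon_{2n})=(e_n,\dots,e_2,e_1,e_1,e_2,\dots,e_n)$, and let $$G(\mathbf e(n))=\langle x,y\mid wx=yw\rangle,\qquad w=x^{\epsilon_1}y^{\epsilon_2}x^{\epsilon_3}y^{\epsilon_4}\cdots x^{\epsilon_{2n-1}}y^{\epsilon_{2n}},$$ be the associated kmot group. Its Riley polynomial $\mathcal R(\lambda)\in\mathbb Z[\lambda]$ is the upper left entry $W_{11}$ of the matrix $$W=\begin{pmatrix}1&1\\0&1\end{pmatrix}^{\epsilon_1}\begin{pmatrix}1&0\\\lambda&1\end{pmatrix}^{\epsilon_2}\cdots\begin{pmatrix}1&1\\0&1\end{pmatrix}^{\epsilon_{2n-1}}\begin{pmatrix}1&0\\\lambda&1\end{pmatrix}^{\epsilon_{2n}}.$$ Let $g_0,g_1,\dots,g_{n+1}\in\mathbb Z[u]$ be defined by $g_0=g_1=1$ and $g_{k+1}(u)=e_k\,u\,g_k(u)-g_{k-1}(u)$ for $1\le k\le n$, and put $v^{\mathbf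 e}_n(u)=g_{n+1}(u)$. Then $\mathcal R(\lambda)$ is irreducible in $\mathbb Z[\lambda]$ if and only if $v^{\mathbf e}_n(u)$ is irreducible in $\mathbb Z[u]$. -/

import Mathlib

open Polynomial

noncomputable section

/-- The two generators `x`, `y` of a two-bridge kmot group. -/
inductive KmotGen where
  | x : KmotGen
  | y : KmotGen

/-- The data of a kmot presentation: an odd integer `α ≥ 3` and a symmetric sequence of signs
`ε₁, …, ε_{α-1}`.  The sign `ε_{i+1}` is stored as `sign i`, so that `Fin.rev` is `i ↦ α - i`
on the one-based indices. -/
structure KmotData where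
  α : ℕ
  odd_α : Odd α
  three_le_α : 3 ≤ α
  sign : Fin (α - 1) → ℤˣ
  symm_sign : ∀ i, sign i.rev = sign i

namespace KmotData

/-- The word `w = x^ε₁ y^ε₂ x^ε₃ y^ε₄ ⋯ x^ε_{α-2} y^ε_{α-1}` in the free group on `x, y`. -/
def word (D : KmotData) : FreeGroup KmotGen :=
  (List.ofFn fun i : Fin (D.α - 1) =>
    FreeGroup.of (if Even (i : ℕ) then KmotGen.x else KmotGen.y) ^ ((D.sign i : ℤˣ) : ℤ)).prod

/-- The kmot group `⟨x, y | w x = y w⟩`. -/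
abbrev group (D : KmotData) : Type :=
  PresentedGroup
    {D.word * FreeGroup.of KmotGen.x * (FreeGroup.of KmotGen.y * D.word)⁻¹}

/-- The parabolic matrices `ρ(x) = (1 1; 0 1)` and `ρ(y) = (1 0; λ 1)` over `ℤ[λ]`. -/
def parabolicGen : KmotGen → Matrix.SpecialLinearGroup (Fin 2) ℤ[X]
  | KmotGen.x => ⟨!![1, 1; 0, 1], by simp [Matrix.det_fin_two_of]⟩
  | KmotGen.y => ⟨!![1, 0; X, 1], by simp [Matrix.det_fin_two_of]⟩

/-- The matrix `W = ρ(w)`, with entries in `ℤ[λ]`. -/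
def W (D : KmotData) : Matrix.SpecialLinearGroup (Fin 2) ℤ[X] :=
  FreeGroup.lift parabolicGen D.word

/-- The Riley polynomial `W₁₁ ∈ ℤ[λ]`. -/
def rileyPolynomial (D : KmotData) : ℤ[X] :=
  (D.W : Matrix (Fin 2) (Fin 2) ℤ[X]) 0 0

/-- The kmot data of the symmetric sequence `e(n) = (e_n, …, e_2, e_1, e_1, e_2, …, e_n)`,
where `α = 2 n + 1`; the sequence `e` is one-based. -/
def ofHalf (n : ℕ) (hn : 1 ≤ n) (e : ℕ → ℤˣ) : KmotData where
  α := 2 * n + 1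
  odd_α := ⟨n, rfl⟩
  three_le_α := by omega
  sign := fun i => if (i : ℕ) < n then e (n - i) else e (i + 1 - n)
  symm_sign := by
    intro i
    have hi : (i : ℕ) < 2 * n := i.isLt
    have hr : (i.rev : ℕ) = 2 * n - 1 - i := by
      rw [Fin.val_rev]; omega
    rw [hr]
    by_cases h : (i : ℕ) < n
    · rw [if_neg (by omega), if_pos h]
      congr 1; omega
    · rw [if_pos (by omega), if_neg h]
      congr 1; omega

end KmotData

/-- The `e`-Chebyshev polynomials with initial values `g₀ = a`, `g₁ = b`, defined by
`g_{k+1}(t) = e_k t g_k(t) - g_{k-1}(t)` for `k ≥ 1`; the sequence `e` is one-based. -/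
def epsChebyshev (e : ℕ → ℤˣ) (a b : ℤ[X]) : ℕ → ℤ[X]
  | 0 => a
  | 1 => b
  | k + 2 => C ((e (k + 1) : ℤˣ) : ℤ) * X * epsChebyshev e a b (k + 1) - epsChebyshev e a b k

/-- The polynomial `v_n^e`, the `(n+1)`-st `e`-Chebyshev polynomial with initial values `1, 1`.
It depends only on `e_1, …, e_n`. -/
def epsV (e : ℕ → ℤˣ) (n : ℕ) : ℤ[X] :=
  epsChebyshev e 1 1 (n + 1)

end

/-! Put `λ = -u²`. Conjugation by `diag(u, 1)` turns each block `ρ(x)^ε ρ(y)^δ` into `-T_ε T_δ`,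
with `T` the transfer matrix of the recursion (`diag_mul_parabolicPow`). By the symmetry of the
signs, `W` becomes `(-1)^n D A`, where `D = T_{e_n} ⋯ T_{e_1}` and `A` is the reversed product.
Since `A = S Dᵗ S` with `S = diag(1, -1)`, the corner of `D A` is `D₀₀² - D₀₁²`, whose two factors
are `v(u)` and `±v(-u)`. Hence `R(-u²) = v(u) v(-u)`. As `v` is not even, irreducibility transfers:
a factor `a` of `v` gives the factor of `R` obtained from the norm `a(u) a(-u)`, while a factor of
`R` divisible by `v` must absorb `v(-u)` too. -/

/-! ### Descent along `λ = -u²`. -/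

section IrreducibilityCriterion

/-- Substituting `-X` detects the parity of coefficients. -/
theorem Polynomial.coeff_comp_neg_X_eq (p : ℤ[X]) (k : ℕ) :
    (p.comp (-X)).coeff k = (-1) ^ k * p.coeff k := by
  have h : (-X : ℤ[X]) = C (-1) * X := by simp
  rw [h, comp_C_mul_X_coeff, mul_comm]

theorem Polynomial.comp_neg_X_sq_eq (p : ℤ[X]) :
    p.comp (-X ^ 2) = expand ℤ 2 (p.comp (-X)) := by
  rw [expand_eq_comp_X_pow, comp_assoc]
  simp

theorem Polynomial.comp_neg_X_sq_injective :
    Function.Injective fun p : ℤ[X] => p.comp (-X ^ 2) := by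
  intro p q h
  simp only [comp_neg_X_sq_eq] at h
  have h' := expand_injective two_pos h
  rw [← comp_neg_X_comp_neg_X p, h', comp_neg_X_comp_neg_X]

theorem Polynomial.isUnit_comp_neg_X_sq_iff (p : ℤ[X]) :
    IsUnit (p.comp (-X ^ 2)) ↔ IsUnit p := by
  constructor
  · intro h
    obtain ⟨r, hr, hp⟩ := Polynomial.isUnit_iff.1 h
    have : p = C r := comp_neg_X_sq_injective (by simpa using hp.symm)
    rw [this]
    exact hr.map C
  · intro h
    exact h.map (compRingHom (-X ^ 2))

theorem Polynomial.isUnit_comp_neg_X_iff (p : ℤ[X]) : IsUnit (p.comp (-X)) ↔ IsUnit p := by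
  constructor
  · intro h
    rw [← comp_neg_X_comp_neg_X p]
    exact h.map (compRingHom (-X))
  · intro h
    exact h.map (compRingHom (-X))

theorem Irreducible.polynomial_comp_neg_X {p : ℤ[X]} (h : Irreducible p) :
    Irreducible (p.comp (-X)) := by
  refine ⟨fun hu => h.not_isUnit ((isUnit_comp_neg_X_iff p).1 hu), fun a b hab => ?_⟩
  have : p = a.comp (-X) * b.comp (-X) := by
    rw [← mul_comp, ← hab, comp_neg_X_comp_neg_X]
  simpa only [isUnit_comp_neg_X_iff] using h.isUnit_or_isUnit this

/-- An even polynomial is a polynomial in `-X ^ 2`. -/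
theorem Polynomial.exists_eq_comp_neg_X_sq {p : ℤ[X]} (h : p.comp (-X) = p) :
    ∃ q : ℤ[X], q.comp (-X ^ 2) = p := by
  -- `contract 2` keeps the even coefficients; `-X` cancels the sign in `-X ^ 2`.
  refine ⟨(contract 2 p).comp (-X), ?_⟩
  rw [comp_neg_X_sq_eq, comp_neg_X_comp_neg_X]
  ext k
  rw [coeff_expand two_pos]
  split_ifs with hk
  · rw [coeff_contract two_ne_zero, Nat.div_mul_cancel hk]
  · have hc := coeff_comp_neg_X_eq p k
    rw [h, Odd.neg_one_pow (Nat.not_even_iff_odd.1 fun he => hk he.two_dvd)] at hc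
    omega

theorem Polynomial.comp_neg_X_sq_comp_neg_X (p : ℤ[X]) :
    (p.comp (-X ^ 2)).comp (-X) = p.comp (-X ^ 2) := by
  simp [comp_assoc]

/-- A factor `v` of `A(-u²)` with constant unit cofactor is even. -/
theorem Polynomial.comp_neg_X_eq_self_of_mul_isUnit {A v c : ℤ[X]} (hc : IsUnit c)
    (h : A.comp (-X ^ 2) = v * c) : v.comp (-X) = v := by
  obtain ⟨r, -, rfl⟩ := Polynomial.isUnit_iff.1 hc
  have h2 := comp_neg_X_sq_comp_neg_X A
  rw [h, mul_comp, C_comp] at h2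
  exact mul_right_cancel₀ hc.ne_zero h2

/-- If an irreducible polynomial `v` that is not even divides `A(-u²)`, where
`A(-u²) B(-u²) = v(u) v(-u)`, then `B` is a unit. -/
theorem Polynomial.isUnit_of_irreducible_dvd {A B v : ℤ[X]} (hv : Irreducible v)
    (hodd : v.comp (-X) ≠ v) (hAB : A.comp (-X ^ 2) * B.comp (-X ^ 2) = v * v.comp (-X))
    (hdvd : v ∣ A.comp (-X ^ 2)) : IsUnit B := by
  obtain ⟨c, hc⟩ := hdvd
  rw [hc, mul_assoc] at hAB
  have h := mul_left_cancel₀ hv.ne_zero hAB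
  -- Here `v(-u) = c(u) B(-u²)`; a unit `c` would make `v` even.
  rcases hv.polynomial_comp_neg_X.isUnit_or_isUnit h.symm with hu | hu
  · exact absurd (comp_neg_X_eq_self_of_mul_isUnit hu hc) hodd
  · exact (isUnit_comp_neg_X_sq_iff B).1 hu

/-- If `R(-u²) = v(u) v(-u)` and `v` is not even, then `R` is irreducible if and only if `v` is. -/
theorem Polynomial.irreducible_iff_of_comp_neg_X_sq {R v : ℤ[X]}
    (hR : R.comp (-X ^ 2) = v * v.comp (-X)) (hodd : v.comp (-X) ≠ v) :
    Irreducible R ↔ Irreducible v := by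
  have hunit : IsUnit R ↔ IsUnit v := by
    rw [← isUnit_comp_neg_X_sq_iff, hR, IsUnit.mul_iff, isUnit_comp_neg_X_iff, and_self]
  constructor
  · intro h
    refine ⟨fun hu => h.not_isUnit (hunit.2 hu), fun a b hab => ?_⟩
    have heven (a : ℤ[X]) : (a * a.comp (-X)).comp (-X) = a * a.comp (-X) := by
      rw [mul_comp, comp_neg_X_comp_neg_X, mul_comm]
    obtain ⟨A, hA⟩ := exists_eq_comp_neg_X_sq (heven a)
    obtain ⟨B, hB⟩ := exists_eq_comp_neg_X_sq (heven b)
    have hRAB : R = A * B := by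
      apply comp_neg_X_sq_injective
      simp only [mul_comp, hA, hB, hR, hab]
      ring
    refine (h.isUnit_or_isUnit hRAB).imp ?_ ?_
    · intro hu
      rw [← isUnit_comp_neg_X_sq_iff, hA] at hu
      exact isUnit_of_mul_isUnit_left hu
    · intro hu
      rw [← isUnit_comp_neg_X_sq_iff, hB] at hu
      exact isUnit_of_mul_isUnit_left hu
  · intro h
    refine ⟨fun hu => h.not_isUnit (hunit.1 hu), fun A B hAB => ?_⟩
    rw [hAB, mul_comp] at hR
    rcases h.prime.dvd_or_dvd (Dvd.intro _ hR.symm) with hd | hd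
    · exact Or.inr (isUnit_of_irreducible_dvd h hodd hR hd)
    · exact Or.inl (isUnit_of_irreducible_dvd h hodd (by rw [mul_comm, hR]) hd)

end IrreducibilityCriterion

/-! ### Top coefficients and parity of `v`. -/

section Chebyshev

theorem epsChebyshev_succ_succ (e : ℕ → ℤˣ) (a b : ℤ[X]) (k : ℕ) :
    epsChebyshev e a b (k + 2) =
      C ((e (k + 1) : ℤˣ) : ℤ) * X * epsChebyshev e a b (k + 1) - epsChebyshev e a b k :=
  rfl

theorem coeff_epsChebyshev_succ_succ (e : ℕ → ℤˣ) (a b : ℤ[X]) (k m : ℕ) :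
    (epsChebyshev e a b (k + 2)).coeff (m + 1) =
      (e (k + 1) : ℤ) * (epsChebyshev e a b (k + 1)).coeff m -
        (epsChebyshev e a b k).coeff (m + 1) := by
  rw [epsChebyshev_succ_succ, coeff_sub, mul_assoc, coeff_C_mul, coeff_X_mul]

theorem coeff_epsChebyshev_eq_zero (e : ℕ → ℤˣ) (k : ℕ) :
    (∀ m, k < m → (epsChebyshev e 1 1 k).coeff m = 0) ∧
      ∀ m, k < m → (epsChebyshev e 1 1 (k + 1)).coeff m = 0 := by
  induction k with
  | zero =>
    constructor <;> intro m hm <;> simp [epsChebyshev, coeff_one, hm.ne']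
  | succ k ih =>
    refine ⟨fun m hm => ih.2 m (by omega), fun m hm => ?_⟩
    obtain ⟨m, rfl⟩ : ∃ l, m = l + 1 := ⟨m - 1, by omega⟩
    rw [coeff_epsChebyshev_succ_succ, ih.1 _ (by omega), ih.2 _ (by omega)]
    simp

/-- The two top coefficients of `g_{k+2}` are units. -/
theorem isUnit_coeff_epsChebyshev (e : ℕ → ℤˣ) (k : ℕ) :
    IsUnit ((epsChebyshev e 1 1 (k + 2)).coeff (k + 1)) ∧
      IsUnit ((epsChebyshev e 1 1 (k + 2)).coeff k) := by
  induction k with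
  | zero =>
    constructor
    · simp [epsChebyshev, coeff_one]
    · simp [epsChebyshev]
  | succ k ih =>
    -- The subtracted `g_{k+1}` has degree at most `k`, so it misses both top coefficients.
    have h := (coeff_epsChebyshev_eq_zero e k).2
    constructor
    · rw [coeff_epsChebyshev_succ_succ, h _ (by omega), sub_zero]
      exact (e (k + 1 + 1)).isUnit.mul ih.1
    · rw [coeff_epsChebyshev_succ_succ, h _ (by omega), sub_zero]
      exact (e (k + 1 + 1)).isUnit.mul ih.2

/-- One of the two nonzero top coefficients sits in odd degree. -/
theorem epsV_comp_neg_X_ne (n : ℕ) (hn : 1 ≤ n) (e : ℕ → ℤˣ) :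
    (epsV e n).comp (-X) ≠ epsV e n := by
  intro h
  obtain ⟨k, rfl⟩ : ∃ k, n = k + 1 := ⟨n - 1, by omega⟩
  obtain ⟨h1, h2⟩ := isUnit_coeff_epsChebyshev e k
  have c1 := coeff_comp_neg_X_eq (epsV e (k + 1)) (k + 1)
  have c2 := coeff_comp_neg_X_eq (epsV e (k + 1)) k
  rw [h] at c1 c2
  have h1 := h1.ne_zero
  have h2 := h2.ne_zero
  change (epsV e (k + 1)).coeff (k + 1) ≠ 0 at h1
  change (epsV e (k + 1)).coeff k ≠ 0 at h2
  rcases neg_one_pow_eq_or ℤ k with hk | hk <;> rw [pow_succ, hk] at c1 <;> rw [hk] at c2 <;> omega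

end Chebyshev

/-! ### Transfer matrices and the splitting. -/

section TransferMatrix

/-- The matrix of one step `(g_k, g_{k-1}) ↦ (g_{k+1}, g_k)` of the recursion of sign `ε`. -/
noncomputable def transferMatrix (ε : ℤˣ) : Matrix (Fin 2) (Fin 2) ℤ[X] :=
  !![C (ε : ℤ) * X, -1; 1, 0]

/-- The product `T_{e_n} ⋯ T_{e_1}` of transfer matrices. -/
noncomputable def descTransfer (e : ℕ → ℤˣ) : ℕ → Matrix (Fin 2) (Fin 2) ℤ[X]
  | 0 => 1
  | n + 1 => transferMatrix (e (n + 1)) * descTransfer e n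

/-- The product `T_{e_1} ⋯ T_{e_n}` of transfer matrices. -/
noncomputable def ascTransfer (e : ℕ → ℤˣ) : ℕ → Matrix (Fin 2) (Fin 2) ℤ[X]
  | 0 => 1
  | n + 1 => ascTransfer e n * transferMatrix (e (n + 1))

/-- Each `T_ε` satisfies `T_εᵗ = S T_ε S` with `S = diag(1, -1)`, so reversing the product is
transposing and conjugating by `S`. -/
theorem ascTransfer_eq (e : ℕ → ℤˣ) (n : ℕ) :
    ascTransfer e n = !![descTransfer e n 0 0, -descTransfer e n 1 0;
      -descTransfer e n 0 1, descTransfer e n 1 1] := by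
  induction n with
  | zero => ext i j : 1; fin_cases i <;> fin_cases j <;> simp [ascTransfer, descTransfer]
  | succ n ih =>
    rw [ascTransfer, ih, descTransfer, transferMatrix]
    ext i j : 1
    fin_cases i <;> fin_cases j <;> simp [Matrix.mul_apply, Fin.sum_univ_two] <;> ring

theorem epsChebyshev_eq_descTransfer (e : ℕ → ℤˣ) (n : ℕ) :
    epsChebyshev e 1 1 (n + 1) = descTransfer e n 0 0 + descTransfer e n 0 1 ∧
      epsChebyshev e 1 1 n = descTransfer e n 1 0 + descTransfer e n 1 1 := by
  induction n with
  | zero => simp [epsChebyshev, descTransfer]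
  | succ n ih =>
    constructor
    · rw [epsChebyshev_succ_succ, ih.1, ih.2, descTransfer, transferMatrix]
      simp [Matrix.mul_apply, Fin.sum_univ_two]
      ring
    · rw [ih.1, descTransfer, transferMatrix]
      simp [Matrix.mul_apply, Fin.sum_univ_two]

/-- Reflects `T_ε(-u) = -S T_ε(u) S`: the substitution flips the off-diagonal entries of `D`, up to
`(-1)^n`. -/
theorem epsChebyshev_comp_neg_X_eq_descTransfer (e : ℕ → ℤˣ) (n : ℕ) :
    (epsChebyshev e 1 1 (n + 1)).comp (-X) =
        (-1) ^ n * (descTransfer e n 0 0 - descTransfer e n 0 1) ∧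
      (epsChebyshev e 1 1 n).comp (-X) =
        (-1) ^ n * (descTransfer e n 1 1 - descTransfer e n 1 0) := by
  induction n with
  | zero => simp [epsChebyshev, descTransfer]
  | succ n ih =>
    constructor
    · rw [epsChebyshev_succ_succ, sub_comp, mul_comp, mul_comp, C_comp, X_comp, ih.1, ih.2,
        descTransfer, transferMatrix]
      simp [Matrix.mul_apply, Fin.sum_univ_two]
      ring
    · rw [ih.1, descTransfer, transferMatrix]
      simp [Matrix.mul_apply, Fin.sum_univ_two]
      ring

/-- The upper left entry of `T_{e_n} ⋯ T_{e_1} T_{e_1} ⋯ T_{e_n}` is `± v(u) v(-u)`. -/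
theorem descTransfer_mul_ascTransfer (e : ℕ → ℤˣ) (n : ℕ) :
    (-1) ^ n * (descTransfer e n * ascTransfer e n) 0 0 =
      epsV e n * (epsV e n).comp (-X) := by
  rw [epsV, (epsChebyshev_comp_neg_X_eq_descTransfer e n).1, (epsChebyshev_eq_descTransfer e n).1,
    ascTransfer_eq]
  simp [Matrix.mul_apply, Fin.sum_univ_two]
  ring

theorem prod_map_transferMatrix_desc (e : ℕ → ℤˣ) (n : ℕ) :
    ((List.range n).map fun i => transferMatrix (e (n - i))).prod = descTransfer e n := by
  induction n with
  | zero => simp [descTransfer]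
  | succ n ih =>
    rw [List.range_succ_eq_map, List.map_cons, List.prod_cons, List.map_map, descTransfer, ← ih]
    simp [Function.comp_def]

theorem prod_map_transferMatrix_asc (e : ℕ → ℤˣ) (n : ℕ) :
    ((List.range n).map fun i => transferMatrix (e (i + 1))).prod = ascTransfer e n := by
  induction n with
  | zero => simp [ascTransfer]
  | succ n ih => rw [List.range_succ, List.map_append, List.prod_append, ih, ascTransfer]; simp

theorem prod_map_transferMatrix_half (e : ℕ → ℤˣ) (n : ℕ) :
    ((List.range (2 * n)).map fun i =>
      transferMatrix (if i < n then e (n - i) else e (i + 1 - n))).prod =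
      descTransfer e n * ascTransfer e n := by
  rw [two_mul, List.range_add, List.map_append, List.prod_append, List.map_map,
    ← prod_map_transferMatrix_desc, ← prod_map_transferMatrix_asc]
  congr 2
  · refine List.map_congr_left fun i hi => ?_
    rw [if_pos (List.mem_range.1 hi)]
  · refine List.map_congr_left fun i _ => ?_
    rw [Function.comp_apply, if_neg (by omega), show n + i + 1 - n = i + 1 by omega]

end TransferMatrix

/-! ### From the word matrix to transfer matrices. -/

section Riley

open KmotData

/-- The matrix `ρ(g)^ε` after the substitution `λ = -u²`. -/
noncomputable def parabolicPow (g : KmotGen) (ε : ℤˣ) : Matrix (Fin 2) (Fin 2) ℤ[X] :=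
  ((parabolicGen g ^ (ε : ℤ) : Matrix.SpecialLinearGroup (Fin 2) ℤ[X]) :
    Matrix (Fin 2) (Fin 2) ℤ[X]).map fun p => p.comp (-X ^ 2)

theorem parabolicPow_x (ε : ℤˣ) : parabolicPow KmotGen.x ε = !![1, C (ε : ℤ); 0, 1] := by
  rcases Int.units_eq_one_or ε with rfl | rfl <;>
    simp only [parabolicPow, Units.val_one, Units.val_neg, zpow_one, zpow_neg,
      Matrix.SpecialLinearGroup.coe_inv, Matrix.adjugate_fin_two] <;>
    ext i j : 1 <;> fin_cases i <;> fin_cases j <;> simp [parabolicGen]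

theorem parabolicPow_y (ε : ℤˣ) :
    parabolicPow KmotGen.y ε = !![1, 0; -(C (ε : ℤ) * X ^ 2), 1] := by
  rcases Int.units_eq_one_or ε with rfl | rfl <;>
    simp only [parabolicPow, Units.val_one, Units.val_neg, zpow_one, zpow_neg,
      Matrix.SpecialLinearGroup.coe_inv, Matrix.adjugate_fin_two] <;>
    ext i j : 1 <;> fin_cases i <;> fin_cases j <;> simp [parabolicGen]

/-- Conjugation by `diag(u, 1)` turns `ρ(x)^ε ρ(y)^δ` into `-T_ε T_δ`. -/
theorem diag_mul_parabolicPow (ε δ : ℤˣ) :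
    !![X, 0; 0, 1] * (parabolicPow KmotGen.x ε * parabolicPow KmotGen.y δ) =
      -(transferMatrix ε * transferMatrix δ) * !![X, 0; 0, 1] := by
  rw [parabolicPow_x, parabolicPow_y, transferMatrix, transferMatrix]
  ext i j : 1
  fin_cases i <;> fin_cases j <;> simp [Matrix.mul_apply, Fin.sum_univ_two] <;> ring

theorem diag_mul_prod_parabolicPow (s : ℕ → ℤˣ) (n : ℕ) :
    !![X, 0; 0, 1] * ((List.range (2 * n)).map fun i =>
      parabolicPow (if Even i then KmotGen.x else KmotGen.y) (s i)).prod =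
      (-1) ^ n * ((List.range (2 * n)).map fun i => transferMatrix (s i)).prod *
        !![X, 0; 0, 1] := by
  induction n with
  | zero => simp
  | succ n ih =>
    have hr : List.range (2 * (n + 1)) = List.range (2 * n) ++ [2 * n, 2 * n + 1] := by
      rw [show 2 * (n + 1) = 2 * n + 1 + 1 by ring, List.range_succ, List.range_succ]
      simp
    have h0 : Even (2 * n) := even_two_mul n
    have h1 : ¬ Even (2 * n + 1) := by simp
    simp only [hr, List.map_append, List.prod_append, List.map_cons, List.map_nil, List.prod_cons,
      List.prod_nil, mul_one, if_pos h0, if_neg h1]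
    rw [← mul_assoc, ih, mul_assoc, diag_mul_parabolicPow, pow_succ]
    simp only [mul_neg, neg_mul, mul_one, mul_assoc]

theorem map_W_ofHalf (n : ℕ) (hn : 1 ≤ n) (e : ℕ → ℤˣ) :
    ((ofHalf n hn e).W : Matrix (Fin 2) (Fin 2) ℤ[X]).map (fun p => p.comp (-X ^ 2)) =
      ((List.range (2 * n)).map fun i =>
        parabolicPow (if Even i then KmotGen.x else KmotGen.y)
          (if i < n then e (n - i) else e (i + 1 - n))).prod := by
  let φ : Matrix.SpecialLinearGroup (Fin 2) ℤ[X] →* Matrix (Fin 2) (Fin 2) ℤ[X] :=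
    ((compRingHom (-X ^ 2 : ℤ[X])).mapMatrix.toMonoidHom).comp
      Matrix.SpecialLinearGroup.coeMonoidHom
  change φ (FreeGroup.lift parabolicGen (ofHalf n hn e).word) = _
  rw [word, map_list_prod, map_list_prod, List.map_ofFn, List.map_ofFn]
  congr 1
  refine List.ext_getElem (by simp [ofHalf]) fun i _ _ => ?_
  simp only [List.getElem_ofFn, List.getElem_map, List.getElem_range, Function.comp_apply,
    map_zpow, FreeGroup.lift_apply_of]
  rfl

/-- The splitting `R(-u²) = v(u) v(-u)` of the Riley polynomial. -/
theorem rileyPolynomial_ofHalf_comp (n : ℕ) (hn : 1 ≤ n) (e : ℕ → ℤˣ) :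
    (ofHalf n hn e).rileyPolynomial.comp (-X ^ 2) = epsV e n * (epsV e n).comp (-X) := by
  have h := diag_mul_prod_parabolicPow (fun i => if i < n then e (n - i) else e (i + 1 - n)) n
  rw [← map_W_ofHalf n hn, prod_map_transferMatrix_half] at h
  have h00 := congrFun (congrFun h 0) 0
  rw [← descTransfer_mul_ascTransfer]
  have hsign : ((-1) ^ n : Matrix (Fin 2) (Fin 2) ℤ[X]) = ((-1) ^ n : ℤ[X]) • 1 := by
    rcases Nat.even_or_odd n with hp | hp <;> simp [hp.neg_one_pow]
  rw [hsign] at h00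
  -- The conjugation was kept free of denominators, so both corners carry a factor `u`.
  apply mul_left_cancel₀ (X_ne_zero (R := ℤ))
  simp [Matrix.mul_apply, Fin.sum_univ_two] at h00
  rw [rileyPolynomial, h00]
  simp [Matrix.mul_apply, Fin.sum_univ_two]
  ring

end Riley

theorem mainTheorem4 (n : ℕ) (hn : 1 ≤ n) (e : ℕ → ℤˣ) :
    Irreducible (KmotData.ofHalf n hn e).rileyPolynomial ↔ Irreducible (epsV e n) :=
  irreducible_iff_of_comp_neg_X_sq (rileyPolynomial_ofHalf_comp n hn e)
    (epsV_comp_neg_X_ne n hn e)
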